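/- Let $n\ge 1$, write points of $\mathbb R^n=\mathbb R^{n-1}\times\mathbb R$ as $(x,y)$, and let $\overline{\mathbb B}$ be the closed Euclidean unit ball of $\mathbb R^n$. For $f:\mathbb R^{n-1}\to\mathbb R$ let $E_f=\{(x,y): y\ge f(x)\}$ be its epigraph. A closed convex set $E\subset\mathbb R^n$ has *bounded convex exhaustion hulls* (BCEH) if $\mathrm{Conv}(E\cup K)\setminus E$ is bounded for every compact convex set $K\subset\mathbb R^n$. A function is *strictly convex near infinity* if, outside some compact set, every point has a convex neighbourhood on which the function is strictly convex. *Strictly convex caps.* Let $O\subset\mathbb R^n$ be open and convex and let $\rho_t:O\to\mathbb R$, $t\in[0,1]$, be a family of $C^1$ functions such that $\rho_t(z)$ and $d\rho_t(z)$ are continuous in $(t,z)$. Put $M_t=\{\rho_t=0\}$, and assume that (a) every $\rho_t$ is strictly convex and $d\rho_t\neq 0$ on $M_t$; (b) $\rho_t\le 0$ on $M_s$ whenever $0\le s<t\le 1$; (c) there is a nonempty relatively open, relatively compact subset $\omega_0$ of $M_0$ such that $M_t\cap M_0=M_t\cap M_s=M_0\setminus\omega_0$ whenever $0\le s<t\le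 1$. Put $\omega_s=M_s\setminus M_0$ for $0<s\le 1$. If the set $C=\bigcup_{s\in[0,1]}\overline{\omega}_s$ is compact and contained in $O$, it is called a *strictly convex cap with the base $\omega_0$*. **Proposition.** Let $E_\phi\subset\mathbb R^n$ be a closed convex set, the epigraph of a function $\phi:\mathbb R^{n-1}\to\mathbb R$, with $C^1$ boundary and having BCEH, where $\phi$ is bounded from below and strictly convex near infinity. Then there is an $r_0>0$ such that for every $r\ge r_0$ the following hold. 1. $\mathrm{Conv}(E_\phi\cup r\overline{\mathbb B})=E_\psi=\{y\ge\psi(x)\}$ is a closed convex set with BCEH, where $\psi:\mathbb R^{n-1}\to\mathbb R$ is a convex function of class $C^1$ such that $\psi\le\phi$ and $\psi=\phi$ outside a compact set. 2. For every $t\in(0,1)$ the function $\phi_t=(1-t)\phi+t\psi$ is strictly convex on $\mathbb R^{n-1}$. 3. For all $0<t_0<t_1<1$ the closure of the set $\{(x,y)\in\mathbb R^n:\phi_{t_1}(x)<y<\phi_{t_0}(x)\}$ is a strictly convex cap with the base contained in the hypersurface $\{y=\phi_{t_0}(x)\}$. -/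

import Mathlib

open Set Filter Topology

/-- The base space `ℝ^m`, where `m = n - 1`. -/
abbrev BaseSpace (m : ℕ) : Type := EuclideanSpace ℝ (Fin m)

/-- The space `ℝ^n = ℝ^m × ℝ`, `n = m + 1`, with its Euclidean norm. A point `z` is the pair
`(z.fst, z.snd) = (x, y)`. -/
abbrev TotalSpace (m : ℕ) : Type := WithLp 2 (BaseSpace m × ℝ)

/-- The epigraph `{(x, y) : y ≥ f x}`. -/
def epi {m : ℕ} (f : BaseSpace m → ℝ) : Set (TotalSpace m) :=
  {z | f z.fst ≤ z.snd}

/-- The graph `{(x, y) : y = f x}`. -/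
def graphOf {m : ℕ} (f : BaseSpace m → ℝ) : Set (TotalSpace m) :=
  {z | z.snd = f z.fst}

/-- The set `E` is closed and convex and has bounded convex exhaustion hulls: for every compact
convex `K` the set `Conv (E ∪ K) \ E` is bounded. -/
structure HasBCEH {V : Type*} [NormedAddCommGroup V] [NormedSpace ℝ V] (E : Set V) : Prop where
  isClosed : IsClosed E
  convex : Convex ℝ E
  isBounded_hull : ∀ K : Set V, IsCompact K → Convex ℝ K →
    Bornology.IsBounded (convexHull ℝ (E ∪ K) \ E)

/-- The set `E` has boundary of class `C¹`: near each of its boundary points it is the sublevel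
set `{ρ ≤ 0}` of a `C¹` function `ρ` with nonvanishing differential. -/
def HasC1Boundary {V : Type*} [NormedAddCommGroup V] [NormedSpace ℝ V] (E : Set V) : Prop :=
  ∀ p ∈ frontier E, ∃ U : Set V, IsOpen U ∧ p ∈ U ∧ ∃ ρ : V → ℝ,
    ContDiffOn ℝ 1 ρ U ∧ (∀ z ∈ U, fderiv ℝ ρ z ≠ 0) ∧ ∀ z ∈ U, z ∈ E ↔ ρ z ≤ 0

/-- Strict convexity near infinity: outside a compact set, each point has a neighbourhood on
which `f` is strictly convex. -/
def StrictlyConvexNearInfinity {V : Type*} [NormedAddCommGroup V] [NormedSpace ℝ V]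
    (f : V → ℝ) : Prop :=
  ∃ K : Set V, IsCompact K ∧ ∀ x, x ∉ K → ∃ U ∈ 𝓝 x, StrictConvexOn ℝ U f

/-- The hypersurface `M_t = {z ∈ O : ρ_t z = 0}`. -/
def levelSet {V : Type*} (O : Set V) (ρ : ℝ → V → ℝ) (t : ℝ) : Set V :=
  {z | z ∈ O ∧ ρ t z = 0}

/-- `ω₀` and `(ρ_t)_{t ∈ [0,1]}` are the data of a strictly convex cap in the open convex set `O`:
a continuous family of strictly convex `C¹` functions whose zero sets `M_t` all
coincide off a nonempty, relatively compact, relatively open subset `ω₀` of `M_0`, while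
the sets `M_t \ M_0` are pairwise disjoint and move in the convex direction. -/
structure IsCapFamily {V : Type*} [NormedAddCommGroup V] [NormedSpace ℝ V]
    (O : Set V) (ρ : ℝ → V → ℝ) (ω₀ : Set V) : Prop where
  isOpen : IsOpen O
  convex : Convex ℝ O
  contDiffOn : ∀ t ∈ Icc (0 : ℝ) 1, ContDiffOn ℝ 1 (ρ t) O
  continuousOn : ContinuousOn (fun q : ℝ × V => ρ q.1 q.2) (Icc (0 : ℝ) 1 ×ˢ O)
  continuousOn_fderiv :
    ContinuousOn (fun q : ℝ × V => fderiv ℝ (ρ q.1) q.2) (Icc (0 : ℝ) 1 ×ˢ O)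
  strictConvexOn : ∀ t ∈ Icc (0 : ℝ) 1, StrictConvexOn ℝ O (ρ t)
  fderiv_ne_zero : ∀ t ∈ Icc (0 : ℝ) 1, ∀ z ∈ levelSet O ρ t, fderiv ℝ (ρ t) z ≠ 0
  nonpos : ∀ s t : ℝ, 0 ≤ s → s < t → t ≤ 1 → ∀ z ∈ levelSet O ρ s, ρ t z ≤ 0
  base_nonempty : ω₀.Nonempty
  base_relOpen : ∃ U : Set V, IsOpen U ∧ ω₀ = U ∩ levelSet O ρ 0
  base_relCompact : IsCompact (closure ω₀) ∧ closure ω₀ ⊆ levelSet O ρ 0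
  inter_zero : ∀ s t : ℝ, 0 ≤ s → s < t → t ≤ 1 →
    levelSet O ρ t ∩ levelSet O ρ 0 = levelSet O ρ 0 \ ω₀
  inter_eq : ∀ s t : ℝ, 0 ≤ s → s < t → t ≤ 1 →
    levelSet O ρ t ∩ levelSet O ρ s = levelSet O ρ 0 \ ω₀

/-- `C` is a strictly convex cap with the base `ω₀`: a compact set of the form
`C = ⋃_{s ∈ [0,1]} closure ω_s`, contained in `O`, where `ω_s = M_s \ M_0` for `0 < s ≤ 1` and the
closure of the base `ω₀` is the term with `s = 0`. (A union over `[0,t]` with `0 < t ≤ 1` has this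
form for the rescaled family `s ↦ ρ (t * s)`.) -/
def IsStrictlyConvexCap {V : Type*} [NormedAddCommGroup V] [NormedSpace ℝ V]
    (C ω₀ : Set V) : Prop :=
  ∃ (O : Set V) (ρ : ℝ → V → ℝ), IsCapFamily O ρ ω₀ ∧ IsCompact C ∧ C ⊆ O ∧
    C = closure ω₀ ∪ ⋃ s ∈ Ioc (0 : ℝ) 1, closure (levelSet O ρ s \ levelSet O ρ 0)

/-- The interpolation `φ_t = (1 - t) φ + t ψ`. -/
def interp {m : ℕ} (φ ψ : BaseSpace m → ℝ) (t : ℝ) (x : BaseSpace m) : ℝ :=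
  (1 - t) * φ x + t * ψ x

/-! A hull adding only a bounded set to the epigraph forces linear growth, `a * ‖x‖ - b ≤ φ x`
(`exists_linear_growth`): otherwise, joining far graph points to a point below the epigraph would
produce far new points. Growth makes the hull with a large ball predictable near the axis: tangent
half-spaces of the ball at lower points whose slope is at most `a` also contain `epi φ`, so over
`‖x‖ ≤ R` the graph of `ψ` is the lower hemisphere (`eq_neg_sqrt_of_convexHull_eq_epi`). With `R`
chosen so that `φ` is locally strictly convex where `R ≤ ‖x‖`, at every point one of `φ`, `ψ` is
locally strictly convex, and each proper interpolation is strictly convex. For smoothness, each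
graph point of `ψ` combines a point of `epi φ` with one of the ball. A hemisphere or a rescaled copy
of the graph of `φ` therefore touches `ψ` from above, and a convex function touched so is
differentiable; differentiable convex functions are `C¹`. The cap is swept out by the graphs of the
interpolations. The function `φ_t x - y` is affine in `y`; composing it with `exp` restores strict
convexity in the vertical direction. -/

/-! ### Differentiability and local strict convexity of convex functions. -/

section ConvexDifferentiability

variable {V : Type*} [NormedAddCommGroup V] [NormedSpace ℝ V] {f g : V → ℝ} {x : V}

theorem ConvexOn.combo_le (hf : ConvexOn ℝ univ f) (x y : V) {a b : ℝ} (ha : 0 ≤ a) (hb : 0 ≤ b)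
    (hab : a + b = 1) : f (a • x + b • y) ≤ a * f x + b * f y :=
  hf.2 (mem_univ x) (mem_univ y) ha hb hab

/-- A convex function touched from above by a function differentiable at the contact point is
differentiable there, with the same derivative. -/
theorem ConvexOn.hasFDerivAt_of_eventually_le (hf : ConvexOn ℝ univ f) {l : V →L[ℝ] ℝ}
    (hg : HasFDerivAt g l x) (hx : f x = g x) (hle : ∀ᶠ y in 𝓝 x, f y ≤ g y) :
    HasFDerivAt f l x := by
  rw [hasFDerivAt_iff_isLittleO_nhds_zero, Asymptotics.isLittleO_iff] at hg ⊢
  intro ε hε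
  have h1 := hg hε
  have hneg : Tendsto (fun h : V => -h) (𝓝 0) (𝓝 0) := by
    simpa using (continuous_neg (G := V)).tendsto 0
  have hadd : Tendsto (fun h : V => x + h) (𝓝 0) (𝓝 x) := by
    have : Continuous fun h : V => x + h := by fun_prop
    simpa using this.tendsto 0
  have h2 := hneg.eventually h1
  have h3 := hadd.eventually hle
  have h4 := hneg.eventually h3
  filter_upwards [h1, h2, h3, h4] with h h1 h2 h3 h4
  rw [Real.norm_eq_abs, abs_le] at h1 h2 ⊢
  simp only [norm_neg, map_neg] at h2
  -- Midpoint convexity turns the upper bound at `x - h` into a lower bound at `x + h`.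
  have hmid := hf.combo_le (x + h) (x + -h) (a := 1 / 2) (b := 1 / 2)
    (by norm_num) (by norm_num) (by norm_num)
  have : (1 / 2 : ℝ) • (x + h) + (1 / 2 : ℝ) • (x + -h) = x := by module
  rw [this] at hmid
  constructor <;> linarith [h1.1, h1.2, h2.1, h2.2]

/-- The derivative of a convex function is a subgradient. -/
theorem ConvexOn.add_fderiv_le (hf : ConvexOn ℝ univ f) {l : V →L[ℝ] ℝ}
    (hl : HasFDerivAt f l x) (v : V) : f x + l v ≤ f (x + v) := by
  have h := (hl.hasLineDerivAt v).tendsto_slope_zero_right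
  have : l v ≤ f (x + v) - f x := by
    refine le_of_tendsto h ?_
    filter_upwards [Ioo_mem_nhdsGT (zero_lt_one' ℝ)] with t ht
    have hc := hf.combo_le x (x + v) (a := 1 - t) (b := t)
      (by linarith [ht.2]) ht.1.le (by ring)
    have e : (1 - t) • x + t • (x + v) = x + t • v := by module
    rw [e] at hc
    rw [smul_eq_mul]
    rw [inv_mul_le_iff₀ ht.1]
    linarith
  linarith

/-- An everywhere differentiable convex function is continuously differentiable. -/
theorem ConvexOn.contDiff_one (hf : ConvexOn ℝ univ f) (hd : Differentiable ℝ f) :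
    ContDiff ℝ 1 f := by
  refine contDiff_one_iff_fderiv.2 ⟨hd, continuous_iff_continuousAt.2 fun x => ?_⟩
  rw [Metric.continuousAt_iff]
  intro ε' hε'
  set ε := ε' / 8 with hε
  have hε0 : 0 < ε := by positivity
  have hx := (hd x).hasFDerivAt
  set l := fderiv ℝ f x with hl
  have hlo := hasFDerivAt_iff_isLittleO_nhds_zero.1 hx
  rw [Asymptotics.isLittleO_iff] at hlo
  obtain ⟨δ, hδ, hδ'⟩ := Metric.eventually_nhds_iff.1 (hlo hε0)
  refine ⟨δ / 4, by positivity, fun y hy => ?_⟩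
  have hyl := (hd y).hasFDerivAt
  set k := fderiv ℝ f y
  rw [dist_eq_norm] at hy
  -- The subgradient inequality gives `k u ≤ f (y + u) - f y`; both points stay within `δ` of `x`,
  -- so each value is within `ε * δ` of the linearization at `x`.
  have hbound : ∀ u : V, ‖u‖ = δ / 2 → (k - l) u ≤ 2 * (ε * δ) := by
    intro u hu
    have h1 := hf.add_fderiv_le hyl u
    have n1 : ‖y - x + u‖ ≤ 3 * δ / 4 := (norm_add_le _ _).trans (by linarith)
    have h2 := hδ' (y := y - x + u) (by rw [dist_zero_right]; linarith)
    have h3 := hδ' (y := y - x) (by rw [dist_zero_right]; linarith)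
    rw [Real.norm_eq_abs, abs_le] at h2 h3
    have e1 : x + (y - x + u) = y + u := by abel
    have e2 : x + (y - x) = y := by abel
    rw [e1, map_add] at h2
    rw [e2] at h3
    have n2 : ε * ‖y - x + u‖ ≤ ε * δ := by gcongr; linarith
    have n3 : ε * ‖y - x‖ ≤ ε * δ := by gcongr; linarith
    simp only [sub_apply]
    linarith [h2.2, h3.1]
  rw [dist_eq_norm]
  refine lt_of_le_of_lt (ContinuousLinearMap.opNorm_le_bound _ (M := 4 * ε) (by positivity) ?_)
    (by rw [hε]; linarith)
  have hone : ∀ v : V, v ≠ 0 → (k - l) v ≤ 4 * ε * ‖v‖ := by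
    intro v hv
    have hv0 : 0 < ‖v‖ := norm_pos_iff.2 hv
    have h := hbound ((δ / 2 / ‖v‖) • v) (by
      rw [norm_smul, Real.norm_of_nonneg (by positivity)]; field_simp)
    rw [map_smul, smul_eq_mul] at h
    have : δ / 2 / ‖v‖ * (k - l) v * (‖v‖ * 2 / δ) ≤ 2 * (ε * δ) * (‖v‖ * 2 / δ) := by gcongr
    calc (k - l) v = δ / 2 / ‖v‖ * (k - l) v * (‖v‖ * 2 / δ) := by field_simp
      _ ≤ _ := this
      _ = _ := by field_simp; ring
  intro v
  by_cases hv : v = 0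
  · simp [hv]
  · rw [Real.norm_eq_abs, abs_le]
    have h1 := hone v hv
    have h2 := hone (-v) (neg_ne_zero.2 hv)
    rw [map_neg, norm_neg] at h2
    constructor <;> linarith

/-- If a convex function is strictly convex near `a • x + b • y`, then the convexity inequality for
this combination is strict. -/
theorem ConvexOn.lt_of_strictConvexOn_nhds (hf : ConvexOn ℝ univ f) {x y : V} (hxy : x ≠ y)
    {a b : ℝ} (ha : 0 < a) (hb : 0 < b) (hab : a + b = 1) {U : Set V}
    (hU : U ∈ 𝓝 (a • x + b • y)) (hs : StrictConvexOn ℝ U f) :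
    f (a • x + b • y) < a * f x + b * f y := by
  have hc : ∀ σ : ℝ, Tendsto (fun s : ℝ => (a + σ * s) • x + (b - σ * s) • y) (𝓝 0)
      (𝓝 (a • x + b • y)) := by
    intro σ
    have : Continuous (fun s : ℝ => (a + σ * s) • x + (b - σ * s) • y) := by fun_prop
    simpa using this.tendsto 0
  -- Shifting the weights by `±s` gives two distinct points of `U` on the segment whose midpoint is
  -- the given combination: strictness at the midpoint, convexity at the two points.
  obtain ⟨s, hs0, ⟨h1, h2⟩, h3, h4⟩ :=
    ((((hc 1).eventually_mem hU).and ((hc (-1)).eventually_mem hU)).and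
      ((eventually_lt_nhds ha).and (eventually_lt_nhds hb))).exists_gt
  have hne : (a + 1 * s) • x + (b - 1 * s) • y ≠ (a + -1 * s) • x + (b - -1 * s) • y := by
    intro h
    have : (2 * s) • (x - y) = 0 := by
      rw [← sub_eq_zero] at h
      rw [← h]; module
    rcases smul_eq_zero.1 this with h | h
    · linarith
    · exact hxy (sub_eq_zero.1 h)
  have hst := hs.2 h1 h2 hne (one_half_pos (α := ℝ)) (one_half_pos (α := ℝ))
    (by norm_num)
  have e : (1 / 2 : ℝ) • ((a + 1 * s) • x + (b - 1 * s) • y) +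
      (1 / 2 : ℝ) • ((a + -1 * s) • x + (b - -1 * s) • y) = a • x + b • y := by module
  rw [e] at hst
  have c1 := hf.combo_le x y (a := a + 1 * s) (b := b - 1 * s)
    (by linarith) (by linarith) (by linarith)
  have c2 := hf.combo_le x y (a := a + -1 * s) (b := b - -1 * s)
    (by linarith) (by linarith) (by linarith)
  simp only [smul_eq_mul] at hst
  linarith

end ConvexDifferentiability

/-! ### Closedness and exhaustion hulls of convex hulls of unions. -/

section Hull

variable {V : Type*} [NormedAddCommGroup V] [NormedSpace ℝ V] {E K : Set V}

theorem mem_convexHull_union_iff (hE : Convex ℝ E) (hK : Convex ℝ K) (hE' : E.Nonempty)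
    (hK' : K.Nonempty) {z : V} : z ∈ convexHull ℝ (E ∪ K) ↔
      ∃ e ∈ E, ∃ k ∈ K, ∃ a b : ℝ, 0 ≤ a ∧ 0 ≤ b ∧ a + b = 1 ∧ a • e + b • k = z := by
  rw [hE.convexHull_union hK hE' hK', mem_convexJoin]
  rfl

/-- If the convex hull of a closed convex set and a compact convex set adds only a bounded set to
the former, then it is closed. -/
theorem isClosed_convexHull_union (hE : Convex ℝ E) (hEc : IsClosed E) (hE' : E.Nonempty)
    (hK : Convex ℝ K) (hKc : IsCompact K) (hK' : K.Nonempty)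
    (hb : Bornology.IsBounded (convexHull ℝ (E ∪ K) \ E)) :
    IsClosed (convexHull ℝ (E ∪ K)) := by
  refine isClosed_of_closure_subset fun z hz => ?_
  obtain ⟨u, hu, huz⟩ := mem_closure_iff_seq_limit.1 hz
  simp only [mem_convexHull_union_iff hE hK hE' hK'] at hu
  choose e he k hk a b ha hb0 hab heq using hu
  have hcpt : IsCompact (Icc (0 : ℝ) 1 ×ˢ K) := isCompact_Icc.prod hKc
  obtain ⟨⟨b₀, k₀⟩, ⟨hb₀, hk₀⟩, σ, hσ, hlim⟩ := hcpt.tendsto_subseq (x := fun n => (b n, k n))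
    (fun n => ⟨⟨hb0 n, by linarith [ha n, hab n]⟩, hk n⟩)
  have hbl : Tendsto (fun n => b (σ n)) atTop (𝓝 b₀) := (continuous_fst.tendsto _).comp hlim
  have hkl : Tendsto (fun n => k (σ n)) atTop (𝓝 k₀) := (continuous_snd.tendsto _).comp hlim
  have hal : Tendsto (fun n => a (σ n)) atTop (𝓝 (1 - b₀)) := by
    have : (fun n => a (σ n)) = fun n => 1 - b (σ n) := by
      ext n; linarith [hab (σ n)]
    rw [this]
    exact hbl.const_sub 1
  have hul : Tendsto (fun n => u (σ n)) atTop (𝓝 z) := huz.comp hσ.tendsto_atTop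
  have hael : Tendsto (fun n => a (σ n) • e (σ n)) atTop (𝓝 (z - b₀ • k₀)) := by
    have : (fun n => a (σ n) • e (σ n)) = fun n => u (σ n) - b (σ n) • k (σ n) := by
      ext n; rw [← heq (σ n)]; abel
    rw [this]
    exact hul.sub (hbl.smul hkl)
  -- If the weight on `E` tends to `0`, the points `e` may escape to infinity and `z - k₀` is a
  -- limiting direction; otherwise `e` converges in `E`.
  rcases (sub_nonneg.2 hb₀.2).eq_or_lt with h0 | h0
  · have hb1 : b₀ = 1 := by linarith
    subst hb1
    rw [one_smul] at hael
    rw [sub_self] at hal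
    have hkH : k₀ ∈ convexHull ℝ (E ∪ K) := subset_convexHull _ _ (Or.inr hk₀)
    by_cases hv : z - k₀ = 0
    · rwa [sub_eq_zero.1 hv]
    obtain ⟨R, hR⟩ := hb.subset_closedBall 0
    have hvpos : 0 < ‖z - k₀‖ := norm_pos_iff.2 hv
    -- Far enough along the ray from `k₀` through `z`, approximating hull points leave the ball
    -- containing the added part, so they lie in `E`; then so does their limit, and `z` is on the
    -- segment from it to `k₀`.
    obtain ⟨s, hs1, hs2⟩ : ∃ s : ℝ, 1 ≤ s ∧ R + ‖k₀‖ < s * ‖z - k₀‖ := by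
      refine ⟨max 1 ((R + ‖k₀‖) / ‖z - k₀‖ + 1), le_max_left _ _, ?_⟩
      rw [← div_lt_iff₀ hvpos]
      exact lt_of_lt_of_le (lt_add_one _) (le_max_right _ _)
    have hwl : Tendsto (fun n => s • (a (σ n) • e (σ n)) + (1 - s * a (σ n)) • k (σ n)) atTop
        (𝓝 (s • (z - k₀) + (1 - s * 0) • k₀)) :=
      (hael.const_smul s).add (((hal.const_mul s).const_sub 1).smul hkl)
    simp only [mul_zero, sub_zero, one_smul] at hwl
    have hnorm : R < ‖s • (z - k₀) + k₀‖ := by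
      have h1 : ‖s • (z - k₀)‖ ≤ ‖s • (z - k₀) + k₀‖ + ‖k₀‖ := by
        simpa using norm_sub_le (s • (z - k₀) + k₀) k₀
      rw [norm_smul, Real.norm_of_nonneg (by linarith)] at h1
      linarith
    have hmem : s • (z - k₀) + k₀ ∈ E := by
      refine hEc.mem_of_tendsto hwl ?_
      have h1 : ∀ᶠ n in atTop, s * a (σ n) < 1 :=
        (hal.const_mul s).eventually (eventually_lt_nhds (by simp))
      filter_upwards [h1, hwl.norm.eventually (eventually_gt_nhds hnorm)] with n hn1 hn2
      by_contra hnE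
      have hnH : s • (a (σ n) • e (σ n)) + (1 - s * a (σ n)) • k (σ n) ∈
          convexHull ℝ (E ∪ K) := by
        rw [smul_smul]
        exact convex_convexHull ℝ (E ∪ K) (subset_convexHull _ _ (Or.inl (he _)))
          (subset_convexHull _ _ (Or.inr (hk _))) (mul_nonneg (by linarith) (ha _))
          (by linarith) (by ring)
      have := hR ⟨hnH, hnE⟩
      rw [mem_closedBall_zero_iff] at this
      linarith
    have hs0 : 0 < s := by linarith
    have hfin := convex_convexHull ℝ (E ∪ K) (subset_convexHull _ _ (Or.inl hmem)) hkH
      (a := s⁻¹) (b := 1 - s⁻¹) (by positivity) (by linarith [inv_le_one_of_one_le₀ hs1])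
      (by ring)
    convert hfin using 1
    rw [smul_add, smul_smul, inv_mul_cancel₀ hs0.ne']
    module
  · have hel : Tendsto (fun n => e (σ n)) atTop (𝓝 ((1 - b₀)⁻¹ • (z - b₀ • k₀))) := by
      refine ((hal.inv₀ h0.ne').smul hael).congr' ?_
      filter_upwards [hal.eventually (eventually_gt_nhds h0)] with n hn
      rw [smul_smul, inv_mul_cancel₀ hn.ne', one_smul]
    have hemem := hEc.mem_of_tendsto hel (Eventually.of_forall fun n => he _)
    rw [mem_convexHull_union_iff hE hK hE' hK']
    refine ⟨_, hemem, k₀, hk₀, 1 - b₀, b₀, h0.le, hb₀.1, by ring, ?_⟩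
    rw [smul_smul, mul_inv_cancel₀ h0.ne']
    module

/-- One larger ball contains both `K` and the given ball, so the new hull lies in the hull of `E`
with it, and removing more than `E` only shrinks the difference. -/
theorem HasBCEH.convexHull_union_closedBall [ProperSpace V] (hE : HasBCEH E) (hE' : E.Nonempty)
    {r : ℝ} (hr : 0 ≤ r) : HasBCEH (convexHull ℝ (E ∪ Metric.closedBall 0 r)) where
  isClosed := isClosed_convexHull_union hE.convex hE.isClosed hE' (convex_closedBall _ _)
    (isCompact_closedBall _ _) (Metric.nonempty_closedBall.2 hr)
    (hE.isBounded_hull _ (isCompact_closedBall _ _) (convex_closedBall _ _))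
  convex := convex_convexHull _ _
  isBounded_hull K hK _ := by
    obtain ⟨R, hR⟩ := (hK.isBounded.union (Metric.isBounded_closedBall (x := 0) (r := r))
      ).subset_closedBall 0
    refine (hE.isBounded_hull (Metric.closedBall 0 R) (isCompact_closedBall _ _)
      (convex_closedBall _ _)).subset (sdiff_subset_sdiff (convexHull_min ?_
        (convex_convexHull _ _)) (subset_union_left.trans (subset_convexHull _ _)))
    refine union_subset (convexHull_mono (union_subset_union_right _
      (subset_union_right.trans hR))) ?_
    exact (subset_union_left.trans hR).trans (subset_union_right.trans (subset_convexHull _ _))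

end Hull

/-! ### Epigraphs: regularity, growth, and hulls with balls. -/

section Epigraph

variable {m : ℕ} {f : BaseSpace m → ℝ}

theorem toLp_mem_epi {x : BaseSpace m} {y : ℝ} :
    (WithLp.toLp 2 (x, y) : TotalSpace m) ∈ epi f ↔ f x ≤ y := Iff.rfl

theorem epi_nonempty : (epi f).Nonempty := ⟨WithLp.toLp 2 (0, f 0), le_refl (f 0)⟩

theorem toLp_combo (a b : ℝ) (x x' : BaseSpace m) (y y' : ℝ) :
    a • (WithLp.toLp 2 (x, y) : TotalSpace m) + b • WithLp.toLp 2 (x', y') =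
      WithLp.toLp 2 (a • x + b • x', a * y + b * y') := rfl

theorem norm_sq_toLp (x : BaseSpace m) (y : ℝ) :
    ‖(WithLp.toLp 2 (x, y) : TotalSpace m)‖ ^ 2 = ‖x‖ ^ 2 + y ^ 2 := by
  rw [WithLp.prod_norm_sq_eq_of_L2]; simp

theorem toLp_mem_closedBall {x : BaseSpace m} {y r : ℝ} (hr : 0 ≤ r) :
    (WithLp.toLp 2 (x, y) : TotalSpace m) ∈ Metric.closedBall 0 r ↔ ‖x‖ ^ 2 + y ^ 2 ≤ r ^ 2 := by
  rw [mem_closedBall_zero_iff, ← sq_le_sq₀ (norm_nonneg _) hr, norm_sq_toLp]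

theorem convexOn_of_convex_epi (h : Convex ℝ (epi f)) : ConvexOn ℝ univ f :=
  ⟨convex_univ, fun x _ y _ _ _ ha hb hab =>
    h (toLp_mem_epi.2 (le_refl (f x))) (toLp_mem_epi.2 (le_refl (f y))) ha hb hab⟩

/-- A closed convex set which is closed under upward translations, lies over the whole base and
is bounded from below is an epigraph. -/
theorem exists_eq_epi {C : Set (TotalSpace m)} (hC : IsClosed C)
    (hup : ∀ x y y', WithLp.toLp 2 (x, y) ∈ C → y ≤ y' → WithLp.toLp 2 (x, y') ∈ C)
    (hne : ∀ x, ∃ y, WithLp.toLp 2 (x, y) ∈ C) {c : ℝ} (hc : ∀ z ∈ C, c ≤ z.snd) :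
    ∃ ψ : BaseSpace m → ℝ, C = epi ψ := by
  refine ⟨fun x => sInf {y | WithLp.toLp 2 (x, y) ∈ C}, ?_⟩
  have hbd : ∀ x, BddBelow {y : ℝ | (WithLp.toLp 2 (x, y) : TotalSpace m) ∈ C} :=
    fun x => ⟨c, fun y hy => hc _ hy⟩
  have hcl : ∀ x, IsClosed {y : ℝ | (WithLp.toLp 2 (x, y) : TotalSpace m) ∈ C} := fun x =>
    hC.preimage ((WithLp.prod_continuous_toLp 2 _ _).comp (by fun_prop : Continuous fun y : ℝ => (x, y)))
  ext z
  constructor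
  · intro hz
    exact csInf_le (hbd _) hz
  · intro hz
    exact hup z.fst _ z.snd ((hcl _).csInf_mem (hne _) (hbd _)) hz

/-- A local equation of an epigraph vanishes on the graph. -/
theorem eq_zero_of_epi_iff {U : Set (TotalSpace m)} (hU : IsOpen U)
    {ρ : TotalSpace m → ℝ} (hρ : ContinuousOn ρ U) (hE : ∀ z ∈ U, z ∈ epi f ↔ ρ z ≤ 0)
    {x : BaseSpace m} (hx : WithLp.toLp 2 (x, f x) ∈ U) : ρ (WithLp.toLp 2 (x, f x)) = 0 := by
  refine le_antisymm ((hE _ hx).1 (toLp_mem_epi.2 le_rfl)) ?_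
  have hl : Tendsto (fun s : ℝ => (WithLp.toLp 2 (x, f x - s) : TotalSpace m)) (𝓝[>] 0)
      (𝓝 (WithLp.toLp 2 (x, f x))) := by
    have : Continuous fun s : ℝ => (WithLp.toLp 2 (x, f x - s) : TotalSpace m) :=
      (WithLp.prod_continuous_toLp 2 _ _).comp (by fun_prop)
    simpa using (this.tendsto 0).mono_left nhdsWithin_le_nhds
  -- Points just below the graph are outside the epigraph, so `ρ` is positive there.
  refine ge_of_tendsto (((hρ.continuousAt (hU.mem_nhds hx)).tendsto).comp hl) ?_
  filter_upwards [hl.eventually_mem (hU.mem_nhds hx), self_mem_nhdsWithin] with s hs hs0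
  by_contra hneg
  have := (hE _ hs).2 (le_of_lt (not_le.1 hneg))
  rw [toLp_mem_epi] at this
  linarith [show (0 : ℝ) < s from hs0]

theorem toLp_mem_frontier_epi (x : BaseSpace m) : WithLp.toLp 2 (x, f x) ∈ frontier (epi f) := by
  refine ⟨subset_closure (toLp_mem_epi.2 le_rfl), fun hint => ?_⟩
  have hl : Tendsto (fun s : ℝ => (WithLp.toLp 2 (x, f x - s) : TotalSpace m)) (𝓝 0)
      (𝓝 (WithLp.toLp 2 (x, f x))) := by
    have : Continuous fun s : ℝ => (WithLp.toLp 2 (x, f x - s) : TotalSpace m) :=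
      (WithLp.prod_continuous_toLp 2 _ _).comp (by fun_prop)
    simpa using this.tendsto 0
  obtain ⟨s, hs0, hs⟩ := (hl.eventually_mem (mem_interior_iff_mem_nhds.1 hint)).exists_gt
  rw [toLp_mem_epi] at hs
  linarith

/-- A convex function whose epigraph has boundary of class `C¹` is differentiable. -/
theorem differentiable_of_hasC1Boundary (hf : ConvexOn ℝ univ f) (h : HasC1Boundary (epi f)) :
    Differentiable ℝ f := by
  intro x
  have hcont : Continuous f := hf.locallyLipschitz.continuous
  obtain ⟨U, hU, hxU, ρ, hρ, hdρ, hE⟩ := h _ (toLp_mem_frontier_epi x)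
  have hD := ((hρ.contDiffAt (hU.mem_nhds hxU)).differentiableAt one_ne_zero).hasFDerivAt
  have hD0 := hdρ _ hxU
  set p : TotalSpace m := WithLp.toLp 2 (x, f x) with hp
  set D := fderiv ℝ ρ p
  obtain ⟨K, t, ht, hK⟩ := hf.locallyLipschitz x
  have hKx : ∀ y ∈ t, |f y - f x| ≤ K * ‖y - x‖ := fun y hy => by
    simpa [dist_eq_norm] using hK.dist_le_mul y hy x (mem_of_mem_nhds ht)
  have hρp : ρ p = 0 := eq_zero_of_epi_iff hU hρ.continuousOn hE hxU
  -- The local Lipschitz bound makes these directions point into the epigraph, where `ρ ≤ 0`.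
  have hcone : ∀ (ξ : BaseSpace m) (η : ℝ), K * ‖ξ‖ ≤ η → D (WithLp.toLp 2 (ξ, η)) ≤ 0 := by
    intro ξ η hξη
    have hl := (hD.hasLineDerivAt (WithLp.toLp 2 (ξ, η))).tendsto_slope_zero_right
    have hmem : Tendsto (fun s : ℝ => p + s • (WithLp.toLp 2 (ξ, η) : TotalSpace m)) (𝓝[>] 0)
        (𝓝 p) := by
      have : Continuous fun s : ℝ => p + s • (WithLp.toLp 2 (ξ, η) : TotalSpace m) := by fun_prop
      simpa using (this.tendsto 0).mono_left nhdsWithin_le_nhds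
    have hmem' : Tendsto (fun s : ℝ => x + s • ξ) (𝓝[>] 0) (𝓝 x) := by
      have : Continuous fun s : ℝ => x + s • ξ := by fun_prop
      simpa using (this.tendsto 0).mono_left nhdsWithin_le_nhds
    refine le_of_tendsto hl ?_
    filter_upwards [hmem.eventually_mem (hU.mem_nhds hxU), hmem'.eventually_mem ht,
      self_mem_nhdsWithin] with s hs hs' hs0
    have hs0 : 0 < s := hs0
    have hin : p + s • (WithLp.toLp 2 (ξ, η) : TotalSpace m) ∈ epi f := by
      change f (x + s • ξ) ≤ f x + s * η
      have h1 := (abs_le.1 (hKx _ hs')).2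
      rw [add_sub_cancel_left, norm_smul, Real.norm_of_nonneg hs0.le] at h1
      nlinarith
    rw [hρp, sub_zero, smul_eq_mul]
    exact mul_nonpos_of_nonneg_of_nonpos (by positivity) ((hE _ hs).1 hin)
  have hsplit : ∀ (ξ : BaseSpace m) (η : ℝ), D (WithLp.toLp 2 (ξ, η)) =
      D (WithLp.toLp 2 (ξ, 0)) + η * D (WithLp.toLp 2 (0, 1)) := by
    intro ξ η
    rw [← smul_eq_mul, ← map_smul, ← map_add]
    congr 1
    change _ = (WithLp.toLp 2 (ξ + η • (0 : BaseSpace m), 0 + η * 1) : TotalSpace m)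
    simp
  set c := D (WithLp.toLp 2 (0, 1)) with hc
  -- Were the vertical derivative zero, `D` would be nonpositive on `ξ` and on `-ξ`, hence zero.
  have hc0 : c ≠ 0 := by
    intro h0
    have h1 : ∀ ξ : BaseSpace m, D (WithLp.toLp 2 (ξ, 0)) ≤ 0 := fun ξ => by
      have := hcone ξ (K * ‖ξ‖) le_rfl
      rw [hsplit, h0, mul_zero, add_zero] at this
      exact this
    refine hD0 (ContinuousLinearMap.ext fun v => ?_)
    change D (WithLp.toLp 2 (v.fst, v.snd)) = 0
    rw [hsplit, h0, mul_zero, add_zero]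
    refine le_antisymm (h1 _) ?_
    have h2 := h1 (-v.fst)
    have h3 : (WithLp.toLp 2 (-v.fst, 0) : TotalSpace m) = -WithLp.toLp 2 (v.fst, 0) := by
      change _ = (WithLp.toLp 2 (-v.fst, -0) : TotalSpace m)
      simp
    rw [h3, map_neg] at h2
    linarith
  set J : BaseSpace m →L[ℝ] TotalSpace m :=
    ((WithLp.prodContinuousLinearEquiv 2 ℝ (BaseSpace m) ℝ).symm : _ →L[ℝ] TotalSpace m).comp
      (ContinuousLinearMap.inl ℝ (BaseSpace m) ℝ) with hJ
  have hJx : ∀ ξ, J ξ = WithLp.toLp 2 (ξ, 0) := fun ξ => rfl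
  have hgc : Continuous fun y : BaseSpace m => (WithLp.toLp 2 (y, f y) : TotalSpace m) :=
    (WithLp.prod_continuous_toLp 2 _ _).comp (by fun_prop)
  have hlo := (hasFDerivAt_iff_isLittleO.1 hD).comp_tendsto (hgc.tendsto x)
  have hO : (fun y : BaseSpace m => (WithLp.toLp 2 (y, f y) : TotalSpace m) - p) =O[𝓝 x]
      fun y => y - x := by
    refine Asymptotics.IsBigO.of_bound (1 + K) ?_
    filter_upwards [ht] with y hy
    have h1 : (WithLp.toLp 2 (y, f y) : TotalSpace m) - p = WithLp.toLp 2 (y - x, f y - f x) := rfl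
    have h2 := hKx y hy
    rw [h1]
    refine abs_le_of_sq_le_sq' ?_ (by positivity) |>.2
    rw [norm_sq_toLp, ← sq_abs (f y - f x)]
    nlinarith [sq_nonneg (K * ‖y - x‖), norm_nonneg (y - x), abs_nonneg (f y - f x), K.2,
      mul_nonneg K.2 (sq_nonneg ‖y - x‖), mul_self_le_mul_self (abs_nonneg (f y - f x)) h2]
  -- Implicit differentiation: `ρ` vanishes along the graph, so the expansion of `ρ` can be solved
  -- for `f y - f x` after division by `c`.
  have hlo2 := (hlo.trans_isBigO hO).const_mul_left (-c⁻¹)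
  refine (hasFDerivAt_iff_isLittleO (f' := -c⁻¹ • D.comp J)).2 (hlo2.congr' ?_ .rfl)
    |>.differentiableAt
  filter_upwards [(hgc.tendsto x).eventually_mem (hU.mem_nhds hxU)] with y hy
  have h1 : (WithLp.toLp 2 (y, f y) : TotalSpace m) - p = WithLp.toLp 2 (y - x, f y - f x) := rfl
  simp only [Function.comp_apply]
  rw [eq_zero_of_epi_iff hU hρ.continuousOn hE hy, hρp, h1, hsplit]
  simp only [smul_apply, ContinuousLinearMap.comp_apply, hJx, smul_eq_mul]
  field_simp
  ring

/-- If a function bounded below has an epigraph with bounded convex exhaustion hulls, then it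
grows at least linearly. -/
theorem exists_linear_growth (h : HasBCEH (epi f)) (hb : BddBelow (range f)) :
    ∃ a b : ℝ, 0 < a ∧ 0 ≤ b ∧ ∀ x, a * ‖x‖ - b ≤ f x := by
  obtain ⟨c, hc⟩ := hb
  have hc : ∀ x, c ≤ f x := fun x => hc (mem_range_self x)
  -- A point one unit below the lower bound; the hull with it adds only a bounded set.
  set q : TotalSpace m := WithLp.toLp 2 (0, c - 1) with hq
  obtain ⟨R', hR'⟩ := (h.isBounded_hull {q} isCompact_singleton
    (convex_singleton q)).subset_closedBall 0
  set R := max R' 0 with hR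
  have hR0 : 0 ≤ R := le_max_right _ _
  refine ⟨1 / (R + 1), |c - 1|, by positivity, abs_nonneg _, fun x => ?_⟩
  have habs := neg_abs_le (c - 1)
  have hdiv : 1 / (R + 1) * ‖x‖ = ‖x‖ / (R + 1) := by ring
  rw [hdiv]
  rcases lt_or_ge ‖x‖ (R + 1) with hx | hx
  · have : ‖x‖ / (R + 1) ≤ 1 := (div_le_one (by positivity)).2 hx.le
    linarith [hc x]
  · have hx0 : 0 < ‖x‖ := by linarith
    -- With this weight the point on the segment from `q` to the graph point over `x` has base norm
    -- `R + 1`. It thus lies in the epigraph, at height at least `c`, which gives `1 ≤ s * (f x - (c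
    -- - 1))`.
    set s := (R + 1) / ‖x‖ with hs
    have hs0 : 0 < s := by positivity
    have hs1 : s ≤ 1 := (div_le_one hx0).2 hx
    have hmem : (WithLp.toLp 2 (s • x, s * f x + (1 - s) * (c - 1)) : TotalSpace m) ∈
        convexHull ℝ (epi f ∪ {q}) := by
      have := convex_convexHull ℝ (epi f ∪ {q})
        (subset_convexHull _ _ (Or.inl (toLp_mem_epi.2 (le_refl (f x)))))
        (subset_convexHull _ _ (Or.inr rfl)) hs0.le (sub_nonneg.2 hs1) (by ring)
      rw [hq, toLp_combo] at this
      simpa using this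
    have hepi : (WithLp.toLp 2 (s • x, s * f x + (1 - s) * (c - 1)) : TotalSpace m) ∈ epi f := by
      by_contra hn
      have h1 := hR' ⟨hmem, hn⟩
      rw [mem_closedBall_zero_iff] at h1
      have h2 := (WithLp.norm_fst_le _
        (WithLp.toLp 2 (s • x, s * f x + (1 - s) * (c - 1)) : TotalSpace m)).trans h1
      simp only [WithLp.toLp_fst] at h2
      rw [norm_smul, Real.norm_of_nonneg hs0.le, hs, div_mul_cancel₀ _ hx0.ne'] at h2
      linarith [le_max_left R' 0]
    rw [toLp_mem_epi] at hepi
    have h3 : 1 ≤ s * (f x - (c - 1)) := by linarith [hc (s • x)]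
    have h4 : ‖x‖ / (R + 1) = s⁻¹ := by rw [hs, inv_div]
    rw [h4]
    have h5 : s⁻¹ ≤ f x - (c - 1) := by
      rwa [inv_le_iff_one_le_mul₀' hs0]
    linarith

/-- The convex hull of the union of a convex epigraph which is bounded below and has bounded convex
exhaustion hulls with a ball is an epigraph. -/
theorem exists_convexHull_eq_epi (h : HasBCEH (epi f)) (hb : BddBelow (range f)) {r : ℝ}
    (hr : 0 ≤ r) : ∃ ψ : BaseSpace m → ℝ,
      convexHull ℝ (epi f ∪ Metric.closedBall (0 : TotalSpace m) r) = epi ψ := by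
  obtain ⟨c, hc⟩ := hb
  have hc : ∀ x, c ≤ f x := fun x => hc (mem_range_self x)
  have hH := h.convexHull_union_closedBall epi_nonempty hr
  refine exists_eq_epi hH.isClosed (fun x y y' hy hyy' => ?_)
    (fun x => ⟨f x, subset_convexHull _ _ (Or.inl (toLp_mem_epi.2 le_rfl))⟩) (c := min c (-r)) ?_
  -- The hull is closed, so `(x, y')` is reached by mixing `(x, y)` with a vanishing share `ε` of a
  -- point of the epigraph at height of order `1 / ε`.
  · have hlim : Tendsto (fun ε : ℝ => (WithLp.toLp 2 (ε • x + (1 - ε) • x,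
        ε * (f x + (y' - y) / ε) + (1 - ε) * y) : TotalSpace m)) (𝓝[>] 0)
        (𝓝 (WithLp.toLp 2 (x, y'))) := by
      have hcont : Continuous fun ε : ℝ => (WithLp.toLp 2 (x,
        ε * f x + (y' - y) + (1 - ε) * y) : TotalSpace m) :=
        (WithLp.prod_continuous_toLp 2 _ _).comp (by fun_prop)
      have := (hcont.tendsto 0).mono_left (nhdsWithin_le_nhds (s := Ioi 0))
      simp only [zero_mul, zero_add, sub_zero, one_mul, sub_add_cancel] at this
      refine this.congr' ?_
      filter_upwards [self_mem_nhdsWithin] with ε hε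
      have hε : (0 : ℝ) < ε := hε
      rw [Convex.combo_self (by ring)]
      congr 3
      field_simp
    refine hH.isClosed.mem_of_tendsto hlim ?_
    filter_upwards [Ioo_mem_nhdsGT (zero_lt_one' ℝ)] with ε hε
    rw [← toLp_combo]
    refine hH.convex (subset_convexHull _ _ (Or.inl (toLp_mem_epi.2 ?_))) hy hε.1.le
      (by linarith [hε.2]) (by ring)
    have : 0 ≤ (y' - y) / ε := div_nonneg (by linarith) hε.1.le
    linarith
  · have hconv : Convex ℝ {z : TotalSpace m | min c (-r) ≤ z.snd} := by
      intro z hz w hw a b ha hb hab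
      change min c (-r) ≤ a * z.snd + b * w.snd
      have h1 := mul_le_mul_of_nonneg_left hz ha
      have h2 := mul_le_mul_of_nonneg_left hw hb
      have h3 : a * min c (-r) + b * min c (-r) = min c (-r) := by rw [← add_mul, hab, one_mul]
      linarith
    refine convexHull_min (union_subset (fun z hz => ?_) fun z hz => ?_) hconv
    · exact (min_le_left _ _).trans ((hc z.fst).trans hz)
    · rw [mem_closedBall_zero_iff] at hz
      have := (WithLp.norm_snd_le _ z).trans hz
      exact (min_le_right _ _).trans (abs_le.1 this).1

end Epigraph

/-! ### The hull function: regularity and strict convexity. -/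

section HullFunction

variable {m : ℕ} {φ ψ : BaseSpace m → ℝ} {r : ℝ}

theorem le_of_convexHull_eq_epi
    (hψ : convexHull ℝ (epi φ ∪ Metric.closedBall (0 : TotalSpace m) r) = epi ψ)
    (x : BaseSpace m) : ψ x ≤ φ x := by
  rw [← toLp_mem_epi, ← hψ]
  exact subset_convexHull _ _ (Or.inl (toLp_mem_epi.2 le_rfl))

theorem convexOn_of_convexHull_eq_epi
    (hψ : convexHull ℝ (epi φ ∪ Metric.closedBall (0 : TotalSpace m) r) = epi ψ) :
    ConvexOn ℝ univ ψ :=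
  convexOn_of_convex_epi (hψ ▸ convex_convexHull ℝ _)

theorem le_neg_sqrt_of_convexHull_eq_epi (hr : 0 ≤ r)
    (hψ : convexHull ℝ (epi φ ∪ Metric.closedBall (0 : TotalSpace m) r) = epi ψ)
    {x : BaseSpace m} (hx : ‖x‖ ≤ r) : ψ x ≤ -√(r ^ 2 - ‖x‖ ^ 2) := by
  rw [← toLp_mem_epi, ← hψ]
  refine subset_convexHull _ _ (Or.inr ((toLp_mem_closedBall hr).2 ?_))
  rw [neg_sq, Real.sq_sqrt (sub_nonneg.2 (pow_le_pow_left₀ (norm_nonneg _) hx 2))]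
  linarith

/-- Where `ψ x < φ x`, the graph point of `ψ` belongs to the bounded set added by the hull. -/
theorem eventuallyEq_of_convexHull_eq_epi (h : HasBCEH (epi φ))
    (hψ : convexHull ℝ (epi φ ∪ Metric.closedBall (0 : TotalSpace m) r) = epi ψ) :
    ψ =ᶠ[cocompact (BaseSpace m)] φ := by
  obtain ⟨R, hR⟩ := (h.isBounded_hull _ (isCompact_closedBall 0 r)
    (convex_closedBall _ _)).subset_closedBall 0
  rw [hψ] at hR
  filter_upwards [(isCompact_closedBall (0 : BaseSpace m) R).compl_mem_cocompact] with x hx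
  refine le_antisymm (le_of_convexHull_eq_epi hψ x) ?_
  by_contra hn
  refine hx ?_
  have h1 := hR ⟨toLp_mem_epi.2 (le_refl (ψ x)), fun h => hn (toLp_mem_epi.1 h)⟩
  rw [mem_closedBall_zero_iff] at h1 ⊢
  exact (WithLp.norm_fst_le _ (WithLp.toLp 2 (x, ψ x) : TotalSpace m)).trans h1

/-- The graph of the hull function does not meet the equator of the ball. -/
theorem norm_lt_of_convexHull_eq_epi (hr : 0 < r)
    (hψ : convexHull ℝ (epi φ ∪ Metric.closedBall (0 : TotalSpace m) r) = epi ψ)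
    {x : BaseSpace m} (hx : ‖x‖ ^ 2 + ψ x ^ 2 ≤ r ^ 2) : ‖x‖ < r := by
  have hle : ‖x‖ ≤ r := by
    rw [← sq_le_sq₀ (norm_nonneg _) hr.le]
    linarith [sq_nonneg (ψ x)]
  refine lt_of_le_of_ne hle fun hxr => ?_
  have h0 : ψ x = 0 := by
    rw [hxr] at hx
    exact pow_eq_zero_iff two_ne_zero |>.1 (le_antisymm (by linarith) (sq_nonneg _))
  have hψc := convexOn_of_convexHull_eq_epi hψ
  set M := ψ ((2 : ℝ) • x) with hM
  -- The ball has a vertical tangent at its equator: moving inward by the fraction `s ^ 2` gives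
  -- depth at least `r * s`. Convexity from there through `x`, where `ψ` would be `0`, to `2 • x`
  -- forces `M` to be arbitrarily large.
  have key : ∀ s : ℝ, 0 < s → s < 1 → r ≤ s * M := by
    intro s hs0 hs1
    have hin : ψ ((1 - s ^ 2) • x) ≤ -(r * s) := by
      rw [← toLp_mem_epi, ← hψ]
      refine subset_convexHull _ _ (Or.inr ((toLp_mem_closedBall hr.le).2 ?_))
      have hs2 : s ^ 2 ≤ 1 := by nlinarith
      rw [norm_smul, Real.norm_of_nonneg (by linarith), hxr]
      have : 0 ≤ r ^ 2 * (s ^ 2 * (1 - s ^ 2)) := by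
        have : 0 ≤ 1 - s ^ 2 := by linarith
        positivity
      linarith
    have hc := hψc.combo_le ((1 - s ^ 2) • x) ((2 : ℝ) • x) (a := 1 / (1 + s ^ 2))
      (b := s ^ 2 / (1 + s ^ 2)) (by positivity) (by positivity) (by field_simp)
    have e : (1 / (1 + s ^ 2)) • ((1 - s ^ 2) • x) + (s ^ 2 / (1 + s ^ 2)) • ((2 : ℝ) • x) = x := by
      rw [smul_smul, smul_smul, ← add_smul]
      have : 1 / (1 + s ^ 2) * (1 - s ^ 2) + s ^ 2 / (1 + s ^ 2) * 2 = 1 := by field_simp; ring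
      rw [this, one_smul]
    rw [e, h0, ← hM] at hc
    have h2 : 0 ≤ ψ ((1 - s ^ 2) • x) + s ^ 2 * M := by
      have h3 : (1 / (1 + s ^ 2) * ψ ((1 - s ^ 2) • x) + s ^ 2 / (1 + s ^ 2) * M) * (1 + s ^ 2) =
        ψ ((1 - s ^ 2) • x) + s ^ 2 * M := by field_simp
      rw [← h3]
      positivity
    have h4 : s * r ≤ s * (s * M) := by linarith
    exact le_of_mul_le_mul_left h4 hs0
  have hlim : Tendsto (fun s : ℝ => s * M) (𝓝[>] 0) (𝓝 0) := by
    have : Continuous fun s : ℝ => s * M := by fun_prop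
    simpa using (this.tendsto 0).mono_left (nhdsWithin_le_nhds (s := Ioi 0))
  have : r ≤ 0 := by
    refine ge_of_tendsto hlim ?_
    filter_upwards [Ioo_mem_nhdsGT (zero_lt_one' ℝ)] with s hs using key s hs.1 hs.2
  linarith

theorem differentiableAt_neg_sqrt {x : BaseSpace m} (hx : ‖x‖ < r) :
    DifferentiableAt ℝ (fun y : BaseSpace m => -√(r ^ 2 - ‖y‖ ^ 2)) x := by
  have h0 : r ^ 2 - ‖x‖ ^ 2 ≠ 0 := by
    have := pow_lt_pow_left₀ hx (norm_nonneg _) two_ne_zero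
    linarith
  exact (((differentiableAt_const _).sub (differentiableAt_id.norm_sq ℝ)).sqrt h0).neg

/-- The hull function is of class `C¹`. -/
theorem contDiff_of_convexHull_eq_epi (hφ : Differentiable ℝ φ) (hconv : Convex ℝ (epi φ))
    (hr : 0 < r)
    (hψ : convexHull ℝ (epi φ ∪ Metric.closedBall (0 : TotalSpace m) r) = epi ψ) :
    ContDiff ℝ 1 ψ := by
  have hψc := convexOn_of_convexHull_eq_epi hψ
  refine hψc.contDiff_one fun x => ?_
  have hmem : WithLp.toLp 2 (x, ψ x) ∈ convexHull ℝ (epi φ ∪ Metric.closedBall 0 r) :=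
    hψ ▸ toLp_mem_epi.2 le_rfl
  obtain ⟨e, he, k, hk, a, b, ha, hb, hab, heq⟩ := (mem_convexHull_union_iff hconv
    (convex_closedBall _ _) epi_nonempty (Metric.nonempty_closedBall.2 hr.le)).1 hmem
  have h1 : a • e.fst + b • k.fst = x := congrArg WithLp.fst heq
  have h2 : a * e.snd + b * k.snd = ψ x := congrArg WithLp.snd heq
  rcases ha.eq_or_lt with h0 | h0
  · have hb1 : b = 1 := by linarith
    rw [← h0, hb1, zero_smul, one_smul, zero_add] at heq
    rw [heq, toLp_mem_closedBall hr.le] at hk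
    have hx := norm_lt_of_convexHull_eq_epi hr hψ hk
    refine (hψc.hasFDerivAt_of_eventually_le (differentiableAt_neg_sqrt hx).hasFDerivAt ?_
      ?_).differentiableAt
    · refine le_antisymm (le_neg_sqrt_of_convexHull_eq_epi hr.le hψ hx.le) ?_
      exact neg_le_of_abs_le (Real.abs_le_sqrt (by linarith))
    · filter_upwards [continuous_norm.continuousAt.eventually_lt_const hx] with y hy
      exact le_neg_sqrt_of_convexHull_eq_epi hr.le hψ hy.le
  -- Keeping the ball point `k` and the weights fixed while the other point moves along the graph of
  -- `φ` stays in the hull; this upper barrier touches `ψ` at `x`.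
  · have hd : DifferentiableAt ℝ (fun y => a * φ (a⁻¹ • (y - b • k.fst)) + b * k.snd) x := by
      have := (hφ (a⁻¹ • (x - b • k.fst))).comp x
        (((differentiableAt_id (𝕜 := ℝ)).sub_const (b • k.fst)).const_smul a⁻¹)
      exact (this.const_mul a).add_const _
    have hle : ∀ y, ψ y ≤ a * φ (a⁻¹ • (y - b • k.fst)) + b * k.snd := by
      intro y
      rw [← toLp_mem_epi, ← hψ]
      have := convex_convexHull ℝ (epi φ ∪ Metric.closedBall 0 r) (subset_convexHull _ _
        (Or.inl (toLp_mem_epi.2 (le_refl (φ (a⁻¹ • (y - b • k.fst)))))))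
        (subset_convexHull _ _ (Or.inr hk)) ha hb hab
      convert this using 1
      change _ = (WithLp.toLp 2 (a • a⁻¹ • (y - b • k.fst) + b • k.fst, _) : TotalSpace m)
      rw [smul_inv_smul₀ h0.ne', sub_add_cancel]
      rfl
    refine (hψc.hasFDerivAt_of_eventually_le hd.hasFDerivAt (le_antisymm (hle x) ?_)
      (Eventually.of_forall hle)).differentiableAt
    have : a⁻¹ • (x - b • k.fst) = e.fst := by
      rw [← h1, add_sub_cancel_right, inv_smul_smul₀ h0.ne']
    rw [this, ← h2]
    have : φ e.fst ≤ e.snd := he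
    gcongr

/-- For a large ball, the hull function agrees with the lower hemisphere over a given ball. -/
theorem eq_neg_sqrt_of_convexHull_eq_epi {a b R : ℝ} (ha : 0 < a) (hb : 0 ≤ b)
    (hgrowth : ∀ x, a * ‖x‖ - b ≤ φ x) (hbr : b ≤ r) (hRr : R + R / a < r)
    (hψ : convexHull ℝ (epi φ ∪ Metric.closedBall (0 : TotalSpace m) r) = epi ψ)
    {x : BaseSpace m} (hx : ‖x‖ ≤ R) : ψ x = -√(r ^ 2 - ‖x‖ ^ 2) := by
  have hR : 0 ≤ R := (norm_nonneg x).trans hx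
  have hRa : 0 ≤ R / a := by positivity
  have hr : 0 ≤ r := hb.trans hbr
  refine le_antisymm (le_neg_sqrt_of_convexHull_eq_epi hr hψ (by linarith)) ?_
  have hpos : 0 < r ^ 2 - ‖x‖ ^ 2 := by nlinarith [norm_nonneg x]
  set h := √(r ^ 2 - ‖x‖ ^ 2) with hh
  have h0 : 0 < h := Real.sqrt_pos.2 hpos
  have hsq : h ^ 2 = r ^ 2 - ‖x‖ ^ 2 := Real.sq_sqrt hpos.le
  have hhr : h ≤ r := by
    rw [← sq_le_sq₀ h0.le hr]; nlinarith [norm_nonneg x]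
  -- The slope `‖x‖ / h` of the hemisphere is at most the growth rate `a`, because `r ^ 2` exceeds
  -- `R ^ 2 + (R / a) ^ 2`.
  have hxa : ‖x‖ / a ≤ h := by
    have h1 : ‖x‖ / a ≤ R / a := by gcongr
    have h2 : 0 ≤ ‖x‖ / a := by positivity
    rw [← sq_le_sq₀ h2 h0.le, hsq]
    nlinarith [norm_nonneg x]
  have hxa : ‖x‖ ≤ h * a := (div_le_iff₀ ha).1 hxa
  -- The half-space bounded by the tangent hyperplane of the ball at `(x, -h)`. It contains the ball
  -- by Cauchy–Schwarz and `epi φ` by the slope bound and `h * b ≤ r ^ 2`.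
  have hhalf : Convex ℝ {z : TotalSpace m | inner ℝ x z.fst - r ^ 2 ≤ h * z.snd} := by
    intro z hz w hw α β hα hβ hαβ
    change inner ℝ x (α • z.fst + β • w.fst) - r ^ 2 ≤ h * (α * z.snd + β * w.snd)
    rw [inner_add_right, inner_smul_right, inner_smul_right]
    have h1 := mul_le_mul_of_nonneg_left hz hα
    have h2 := mul_le_mul_of_nonneg_left hw hβ
    have h3 : α * r ^ 2 + β * r ^ 2 = r ^ 2 := by rw [← add_mul, hαβ, one_mul]
    linarith
  have hsub : epi ψ ⊆ {z : TotalSpace m | inner ℝ x z.fst - r ^ 2 ≤ h * z.snd} := by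
    rw [← hψ]
    refine convexHull_min (union_subset (fun z hz => ?_) fun z hz => ?_) hhalf
    · have h1 : φ z.fst ≤ z.snd := hz
      have h2 := real_inner_le_norm x z.fst
      have h3 : h * (a * ‖z.fst‖ - b) ≤ h * z.snd :=
        mul_le_mul_of_nonneg_left ((hgrowth _).trans h1) h0.le
      have h4 : ‖x‖ * ‖z.fst‖ ≤ h * a * ‖z.fst‖ := by gcongr
      have h5 : h * b ≤ r ^ 2 := by nlinarith
      change inner ℝ x z.fst - r ^ 2 ≤ h * z.snd
      linarith
    · rw [mem_closedBall_zero_iff] at hz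
      have h1 := real_inner_le_norm (WithLp.toLp 2 (x, -h) : TotalSpace m) z
      have h2 : ‖(WithLp.toLp 2 (x, -h) : TotalSpace m)‖ ≤ r := by
        rw [← sq_le_sq₀ (norm_nonneg _) hr, norm_sq_toLp, neg_sq, hsq]
        linarith
      have h3 : ‖(WithLp.toLp 2 (x, -h) : TotalSpace m)‖ * ‖z‖ ≤ r * r := by gcongr
      rw [WithLp.prod_inner_apply] at h1
      have h4 : inner ℝ (-h) z.snd = -(h * z.snd) := by
        simp [mul_comm]
      change inner ℝ x z.fst + inner ℝ (-h) z.snd ≤ _ at h1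
      rw [h4] at h1
      change inner ℝ x z.fst - r ^ 2 ≤ h * z.snd
      linarith
  have hfin : inner ℝ x x - r ^ 2 ≤ h * ψ x := hsub (toLp_mem_epi.2 (le_refl (ψ x)))
  rw [real_inner_self_eq_norm_sq] at hfin
  have : h * -h ≤ h * ψ x := by nlinarith
  exact le_of_mul_le_mul_left this h0

/-- Strict convexity of the Euclidean ball: a proper combination of two distinct hemisphere points
falls in the open ball, hence above the hemisphere. -/
theorem strictConvexOn_neg_sqrt {R : ℝ} (hR : R ≤ r) :
    StrictConvexOn ℝ (Metric.ball (0 : BaseSpace m) R) fun x => -√(r ^ 2 - ‖x‖ ^ 2) := by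
  refine ⟨convex_ball _ _, fun x hx y hy hxy a b ha hb hab => ?_⟩
  rw [mem_ball_zero_iff] at hx hy
  have hr : 0 < r := (norm_nonneg x).trans_lt (hx.trans_le hR)
  have hmem : ∀ z : BaseSpace m, ‖z‖ < R → (WithLp.toLp 2 (z, -√(r ^ 2 - ‖z‖ ^ 2)) : TotalSpace m) ∈
      Metric.closedBall 0 r := fun z hz => by
    rw [toLp_mem_closedBall hr.le, neg_sq, Real.sq_sqrt (by nlinarith [norm_nonneg z])]
    linarith
  have h := combo_mem_ball_of_ne (hmem x hx) (hmem y hy)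
    (fun h => hxy (congrArg WithLp.fst h)) ha hb hab
  rw [toLp_combo, mem_ball_zero_iff, ← sq_lt_sq₀ (norm_nonneg _) hr.le, norm_sq_toLp] at h
  have := Real.lt_sqrt_of_sq_lt (x := a * √(r ^ 2 - ‖x‖ ^ 2) + b * √(r ^ 2 - ‖y‖ ^ 2))
    (y := r ^ 2 - ‖a • x + b • y‖ ^ 2) (by linarith)
  simp only [smul_eq_mul]
  linarith

/-- For a large ball, every point has a neighbourhood on which one of the two functions is strictly
convex, so the interpolations are strictly convex. -/
theorem strictConvexOn_interp {a b R : ℝ} (ha : 0 < a) (hb : 0 ≤ b)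
    (hgrowth : ∀ x, a * ‖x‖ - b ≤ φ x) (hbr : b ≤ r) (hR : 0 ≤ R) (hRr : R + R / a < r)
    (hφ : ConvexOn ℝ univ φ)
    (hs : ∀ x, R ≤ ‖x‖ → ∃ U ∈ 𝓝 x, StrictConvexOn ℝ U φ)
    (hψ : convexHull ℝ (epi φ ∪ Metric.closedBall (0 : TotalSpace m) r) = epi ψ)
    {t : ℝ} (ht0 : 0 < t) (ht1 : t < 1) : StrictConvexOn ℝ univ (interp φ ψ t) := by
  have hψc := convexOn_of_convexHull_eq_epi hψ
  refine ⟨convex_univ, fun x _ y _ hxy α β hα hβ hαβ => ?_⟩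
  have h1 := hφ.combo_le x y hα.le hβ.le hαβ
  have h2 := hψc.combo_le x y hα.le hβ.le hαβ
  have ht1' : 0 < 1 - t := sub_pos.2 ht1
  simp only [interp, smul_eq_mul]
  -- Only the position of the combined point matters: near it one function is strictly convex, and
  -- the other contributes its nonstrict inequality.
  rcases lt_or_ge ‖α • x + β • y‖ R with hz | hz
  · have hstr : StrictConvexOn ℝ (Metric.ball (0 : BaseSpace m) R) ψ := by
      refine (strictConvexOn_neg_sqrt (r := r) ?_).congr fun z hz => ?_
      · have : 0 ≤ R / a := by positivity
        linarith
      · rw [mem_ball_zero_iff] at hz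
        exact (eq_neg_sqrt_of_convexHull_eq_epi ha hb hgrowth hbr hRr hψ hz.le).symm
    have h3 := hψc.lt_of_strictConvexOn_nhds hxy hα hβ hαβ
      (Metric.isOpen_ball.mem_nhds (mem_ball_zero_iff.2 hz)) hstr
    nlinarith [mul_le_mul_of_nonneg_left h1 ht1'.le, mul_lt_mul_of_pos_left h3 ht0]
  · obtain ⟨U, hU, hUs⟩ := hs _ hz
    have h3 := hφ.lt_of_strictConvexOn_nhds hxy hα hβ hαβ hU hUs
    nlinarith [mul_le_mul_of_nonneg_left h2 ht0.le, mul_lt_mul_of_pos_left h3 ht1']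

end HullFunction

theorem fderiv_eq_of_forall_hasFDerivAt {V : Type*} [NormedAddCommGroup V] [NormedSpace ℝ V]
    {f : V → ℝ} {f' : V → V →L[ℝ] ℝ} (h : ∀ z, HasFDerivAt f (f' z) z) : fderiv ℝ f = f' :=
  funext fun z => (h z).fderiv

/-! ### The strictly convex cap between two interpolations. -/

section Cap

variable {m : ℕ} {φ ψ : BaseSpace m → ℝ}

/-- A defining function of the graph of `interp φ ψ t` which is strictly convex also in the
vertical direction. -/
noncomputable def graphDefining (φ ψ : BaseSpace m → ℝ) (t : ℝ) (z : TotalSpace m) : ℝ :=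
  Real.exp (interp φ ψ t z.fst - z.snd) - 1

/-- The differential of `graphDefining`. -/
noncomputable def graphDefiningDeriv (φ ψ : BaseSpace m → ℝ) (t : ℝ) (z : TotalSpace m) :
    TotalSpace m →L[ℝ] ℝ :=
  Real.exp (interp φ ψ t z.fst - z.snd) •
    (((1 - t) • fderiv ℝ φ z.fst + t • fderiv ℝ ψ z.fst).comp
      (WithLp.fstL 2 ℝ (BaseSpace m) ℝ) - WithLp.sndL 2 ℝ (BaseSpace m) ℝ)

theorem graphDefining_eq_zero {t : ℝ} {z : TotalSpace m} :
    graphDefining φ ψ t z = 0 ↔ z.snd = interp φ ψ t z.fst := by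
  rw [graphDefining, sub_eq_zero, Real.exp_eq_one_iff, sub_eq_zero, eq_comm]

theorem total_ext {z w : TotalSpace m} (h1 : z.fst = w.fst) (h2 : z.snd = w.snd) : z = w :=
  WithLp.ofLp_injective 2 (Prod.ext h1 h2)

theorem interp_sub_interp (s t : ℝ) (x : BaseSpace m) :
    interp φ ψ s x - interp φ ψ t x = (t - s) * (φ x - ψ x) := by
  simp only [interp]; ring

theorem interp_eq_interp_iff {s t : ℝ} (hst : s ≠ t) (x : BaseSpace m) :
    interp φ ψ s x = interp φ ψ t x ↔ φ x = ψ x := by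
  rw [← sub_eq_zero, interp_sub_interp, mul_eq_zero, sub_eq_zero, sub_eq_zero]
  exact or_iff_right hst.symm

theorem continuous_interp (hφ : Continuous φ) (hψ : Continuous ψ) :
    Continuous fun q : ℝ × BaseSpace m => interp φ ψ q.1 q.2 := by
  simp only [interp]
  fun_prop

theorem continuous_graphPoint (hφ : Continuous φ) (hψ : Continuous ψ) :
    Continuous fun q : ℝ × BaseSpace m =>
      (WithLp.toLp 2 (q.2, interp φ ψ q.1 q.2) : TotalSpace m) :=
  (WithLp.prod_continuous_toLp 2 _ _).comp (continuous_snd.prodMk (continuous_interp hφ hψ))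

theorem continuous_graphDefining (hφ : Continuous φ) (hψ : Continuous ψ) :
    Continuous fun q : ℝ × TotalSpace m => graphDefining φ ψ q.1 q.2 := by
  simp only [graphDefining, interp]
  fun_prop

theorem hasFDerivAt_graphDefining (hφ : Differentiable ℝ φ) (hψ : Differentiable ℝ ψ) (t : ℝ)
    (z : TotalSpace m) :
    HasFDerivAt (graphDefining φ ψ t) (graphDefiningDeriv φ ψ t z) z := by
  have h1 : HasFDerivAt (interp φ ψ t)
      ((1 - t) • fderiv ℝ φ z.fst + t • fderiv ℝ ψ z.fst) z.fst :=
    ((hφ z.fst).hasFDerivAt.const_mul (1 - t)).add ((hψ z.fst).hasFDerivAt.const_mul t)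
  have h2 : HasFDerivAt (fun z : TotalSpace m => z.fst) (WithLp.fstL 2 ℝ (BaseSpace m) ℝ) z :=
    (WithLp.fstL 2 ℝ (BaseSpace m) ℝ).hasFDerivAt
  have h3 : HasFDerivAt (fun z : TotalSpace m => z.snd) (WithLp.sndL 2 ℝ (BaseSpace m) ℝ) z :=
    (WithLp.sndL 2 ℝ (BaseSpace m) ℝ).hasFDerivAt
  exact ((h1.comp z h2).sub h3).exp.sub_const 1

theorem continuous_graphDefiningDeriv (hφ : ContDiff ℝ 1 φ) (hψ : ContDiff ℝ 1 ψ) :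
    Continuous fun q : ℝ × TotalSpace m => graphDefiningDeriv φ ψ q.1 q.2 := by
  have h1 : Continuous fun q : ℝ × TotalSpace m => fderiv ℝ φ q.2.fst :=
    (hφ.continuous_fderiv one_ne_zero).comp (by fun_prop)
  have h2 : Continuous fun q : ℝ × TotalSpace m => fderiv ℝ ψ q.2.fst :=
    (hψ.continuous_fderiv one_ne_zero).comp (by fun_prop)
  have h3 := hφ.continuous
  have h4 := hψ.continuous
  have h5 : Continuous fun q : ℝ × TotalSpace m => Real.exp (interp φ ψ q.1 q.2.fst - q.2.snd) := by
    simp only [interp]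
    fun_prop
  exact h5.smul (((((continuous_const.sub continuous_fst).smul h1).add
    (continuous_fst.smul h2)).clm_comp continuous_const).sub continuous_const)

theorem fderiv_graphDefining (hφ : ContDiff ℝ 1 φ) (hψ : ContDiff ℝ 1 ψ) (t : ℝ) :
    fderiv ℝ (graphDefining φ ψ t) = graphDefiningDeriv φ ψ t :=
  fderiv_eq_of_forall_hasFDerivAt (hasFDerivAt_graphDefining (hφ.differentiable one_ne_zero)
    (hψ.differentiable one_ne_zero) t)

theorem contDiff_graphDefining (hφ : ContDiff ℝ 1 φ) (hψ : ContDiff ℝ 1 ψ) (t : ℝ) :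
    ContDiff ℝ 1 (graphDefining φ ψ t) := by
  have h := hasFDerivAt_graphDefining (hφ.differentiable one_ne_zero)
    (hψ.differentiable one_ne_zero) t
  refine contDiff_one_iff_fderiv.2 ⟨fun z => (h z).differentiableAt, ?_⟩
  rw [fderiv_graphDefining hφ hψ]
  exact (continuous_graphDefiningDeriv hφ hψ).comp (continuous_const.prodMk continuous_id)

theorem graphDefiningDeriv_ne_zero (t : ℝ) (z : TotalSpace m) : graphDefiningDeriv φ ψ t z ≠ 0 := by
  intro h
  have h1 := congrArg (fun l : TotalSpace m →L[ℝ] ℝ => l (WithLp.toLp 2 (0, 1))) h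
  simp [graphDefiningDeriv] at h1

/-- Strictness comes from the exponential when the two points share a base point, and from the
interpolation when they do not. -/
theorem strictConvexOn_graphDefining {t : ℝ} (h : StrictConvexOn ℝ univ (interp φ ψ t)) :
    StrictConvexOn ℝ univ (graphDefining φ ψ t) := by
  refine ⟨convex_univ, fun z _ w _ hzw a b ha hb hab => ?_⟩
  set u := interp φ ψ t z.fst - z.snd with hu
  set v := interp φ ψ t w.fst - w.snd with hv
  have hexp : Real.exp (a * u + b * v) ≤ a * Real.exp u + b * Real.exp v :=
    convexOn_exp.combo_le u v ha.le hb.le hab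
  simp only [graphDefining, smul_eq_mul]
  rw [← hu, ← hv]
  suffices Real.exp (interp φ ψ t (a • z + b • w).fst - (a • z + b • w).snd) <
      a * Real.exp u + b * Real.exp v by linarith
  change Real.exp (interp φ ψ t (a • z.fst + b • w.fst) - (a * z.snd + b * w.snd)) < _
  by_cases hfst : z.fst = w.fst
  · have hsnd : z.snd ≠ w.snd := fun hs => hzw (total_ext hfst hs)
    have huv : u ≠ v := fun he => hsnd (by rw [hu, hv, hfst] at he; linarith)
    have hs := strictConvexOn_exp.2 (mem_univ u) (mem_univ v) huv ha hb hab
    simp only [smul_eq_mul] at hs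
    refine lt_of_eq_of_lt ?_ hs
    rw [hu, hv, hfst, Convex.combo_self hab]
    congr 1
    linear_combination (-interp φ ψ t w.fst) * hab
  · have hs := h.2 (mem_univ z.fst) (mem_univ w.fst) hfst ha hb hab
    simp only [smul_eq_mul] at hs
    refine lt_of_lt_of_le (Real.exp_lt_exp.2 ?_) hexp
    rw [hu, hv]
    linarith

theorem levelSet_graphDefining (τ : ℝ → ℝ) (s : ℝ) :
    levelSet univ (fun s => graphDefining φ ψ (τ s)) s =
      {z : TotalSpace m | z.snd = interp φ ψ (τ s) z.fst} := by
  ext z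
  exact (and_iff_right (mem_univ z)).trans graphDefining_eq_zero

theorem eq_iff_not_lt_of_le (hle : ∀ x, ψ x ≤ φ x) (x : BaseSpace m) :
    φ x = ψ x ↔ ¬ψ x < φ x :=
  ⟨fun h => h.not_gt, fun h => le_antisymm (not_lt.1 h) (hle x)⟩

/-- The part of the graph of an interpolation over the set where the two functions differ. -/
def graphPart (φ ψ : BaseSpace m → ℝ) (t : ℝ) : Set (TotalSpace m) :=
  {z | z.snd = interp φ ψ t z.fst ∧ ψ z.fst < φ z.fst}

theorem toLp_mem_closure_graphPart (hφ : Continuous φ) (hψ : Continuous ψ) (t : ℝ)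
    {x : BaseSpace m} (hx : x ∈ closure {x | ψ x < φ x}) :
    (WithLp.toLp 2 (x, interp φ ψ t x) : TotalSpace m) ∈ closure (graphPart φ ψ t) :=
  map_mem_closure (f := fun x => (WithLp.toLp 2 (x, interp φ ψ t x) : TotalSpace m))
    ((continuous_graphPoint hφ hψ).comp (continuous_const.prodMk continuous_id)) hx
    fun _ hy => ⟨rfl, hy⟩

theorem isCompact_closure_graphPart (hφ : Continuous φ) (hψ : Continuous ψ)
    (hbd : Bornology.IsBounded {x | ψ x < φ x}) (t : ℝ) :
    IsCompact (closure (graphPart φ ψ t)) := by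
  have hQ : IsCompact ((fun x => (WithLp.toLp 2 (x, interp φ ψ t x) : TotalSpace m)) ''
      closure {x | ψ x < φ x}) := hbd.isCompact_closure.image
    ((continuous_graphPoint hφ hψ).comp (continuous_const.prodMk continuous_id))
  exact hQ.of_isClosed_subset isClosed_closure (closure_minimal
    (fun z hz => ⟨z.fst, subset_closure hz.2, total_ext rfl hz.1.symm⟩) hQ.isClosed)

variable {τ : ℝ → ℝ}

/-- The interpolations form the family of a strictly convex cap. -/
theorem isCapFamily_graphDefining (hφ : ContDiff ℝ 1 φ) (hψ : ContDiff ℝ 1 ψ)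
    (hle : ∀ x, ψ x ≤ φ x) (hne : {x | ψ x < φ x}.Nonempty)
    (hbd : Bornology.IsBounded {x | ψ x < φ x}) (hτc : Continuous τ) (hτm : StrictMono τ)
    (hstr : ∀ s ∈ Icc (0 : ℝ) 1, StrictConvexOn ℝ univ (interp φ ψ (τ s))) :
    IsCapFamily univ (fun s => graphDefining φ ψ (τ s)) (graphPart φ ψ (τ 0)) := by
  have hφc := hφ.continuous
  have hψc := hψ.continuous
  have hfd := fderiv_graphDefining hφ hψ
  have hM := levelSet_graphDefining (φ := φ) (ψ := ψ) τ
  have hnot := eq_iff_not_lt_of_le hle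
  refine
    { isOpen := isOpen_univ
      convex := convex_univ
      contDiffOn := fun s _ => (contDiff_graphDefining hφ hψ _).contDiffOn
      continuousOn := ((continuous_graphDefining hφc hψc).comp
        ((hτc.comp continuous_fst).prodMk continuous_snd)).continuousOn
      continuousOn_fderiv := ?_
      strictConvexOn := fun s hs => strictConvexOn_graphDefining
        (hstr s hs)
      fderiv_ne_zero := fun s _ z _ => by
        rw [hfd]
        exact graphDefiningDeriv_ne_zero _ _
      nonpos := fun s t _ hst _ z hz => ?_
      base_nonempty := ?_
      base_relOpen := ⟨{z | ψ z.fst < φ z.fst}, ?_, ?_⟩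
      base_relCompact := ⟨isCompact_closure_graphPart hφc hψc hbd _, ?_⟩
      inter_zero := fun s t hs hst ht => ?_
      inter_eq := fun s t hs hst ht => ?_ }
  · simp only [hfd]
    exact ((continuous_graphDefiningDeriv hφ hψ).comp
        ((hτc.comp continuous_fst).prodMk continuous_snd)).continuousOn
  · rw [hM, mem_ofPred_eq] at hz
    have e1 := interp_sub_interp (φ := φ) (ψ := ψ) (τ s) (τ t) z.fst
    have e2 := mul_nonneg (sub_nonneg.2 (hτm.monotone hst.le)) (sub_nonneg.2 (hle z.fst))
    simp only [graphDefining]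
    rw [hz, sub_nonpos, Real.exp_le_one_iff]
    linarith
  · obtain ⟨x, hx⟩ := hne
    exact ⟨WithLp.toLp 2 (x, interp φ ψ (τ 0) x), rfl, hx⟩
  · exact isOpen_lt (by fun_prop) (by fun_prop)
  · rw [hM]
    ext z
    exact and_comm
  · rw [hM]
    refine closure_minimal (fun z hz => hz.1) (isClosed_eq (by fun_prop) ?_)
    exact (continuous_interp hφc hψc).comp (by fun_prop : Continuous fun z : TotalSpace m =>
      (τ 0, z.fst))
  -- Two distinct interpolations agree exactly on the contact set `φ = ψ`, whatever the parameters.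
  · rw [hM, hM]
    ext z
    simp only [mem_inter_iff, Set.mem_sdiff, mem_ofPred_eq, graphPart]
    have := interp_eq_interp_iff (φ := φ) (ψ := ψ)
      ((hτm (hs.trans_lt hst)).ne) z.fst
    rw [hnot] at this
    constructor
    · rintro ⟨ha, hb⟩
      exact ⟨hb, fun h => this.1 (hb.symm.trans ha) h.2⟩
    · rintro ⟨ha, hb⟩
      exact ⟨ha.trans (this.2 fun h => hb ⟨ha, h⟩), ha⟩
  · rw [hM, hM, hM]
    ext z
    simp only [mem_inter_iff, Set.mem_sdiff, mem_ofPred_eq, graphPart]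
    have h2 := interp_eq_interp_iff (φ := φ) (ψ := ψ) (hτm hst).ne z.fst
    rw [hnot] at h2
    have h3 : ¬ψ z.fst < φ z.fst → ∀ t, interp φ ψ t z.fst = φ z.fst := fun h t => by
      rw [interp, ← (hnot z.fst).2 h]
      ring
    constructor
    · rintro ⟨ha, hb⟩
      have h := h2.1 (hb.symm.trans ha)
      rw [h3 h] at hb
      rw [h3 h]
      exact ⟨hb, fun hn => h hn.2⟩
    · rintro ⟨ha, hb⟩
      have h : ¬ψ z.fst < φ z.fst := fun h => hb ⟨ha, h⟩
      rw [h3 h] at ha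
      rw [h3 h, h3 h]
      exact ⟨ha, ha⟩

/-- The region between two interpolations is swept out by the intermediate ones. -/
theorem closure_between_eq (hφ : Continuous φ) (hψ : Continuous ψ) (hle : ∀ x, ψ x ≤ φ x)
    (hbd : Bornology.IsBounded {x | ψ x < φ x}) (hτc : Continuous τ) (hτm : StrictMono τ) :
    closure {z : TotalSpace m |
        interp φ ψ (τ 1) z.fst < z.snd ∧ z.snd < interp φ ψ (τ 0) z.fst} =
      (fun q : ℝ × BaseSpace m => (WithLp.toLp 2 (q.2, interp φ ψ (τ q.1) q.2) : TotalSpace m)) ''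
        (Icc 0 1 ×ˢ closure {x | ψ x < φ x}) := by
  have hgc : Continuous fun q : ℝ × BaseSpace m =>
      (WithLp.toLp 2 (q.2, interp φ ψ (τ q.1) q.2) : TotalSpace m) :=
    (continuous_graphPoint hφ hψ).comp ((hτc.comp continuous_fst).prodMk continuous_snd)
  have hQc := (isCompact_Icc (a := (0 : ℝ)) (b := 1)).prod hbd.isCompact_closure |>.image hgc
  refine Subset.antisymm (closure_minimal (fun z hz => ?_) hQc.isClosed) ?_
  -- The intermediate value theorem puts `z` on one of the graphs; over the contact set the two
  -- bounding graphs coincide, leaving no room for `z`.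
  · have hc : ContinuousOn (fun s => interp φ ψ (τ s) z.fst) (Icc 0 1) :=
      ((continuous_interp hφ hψ).comp (hτc.prodMk continuous_const)).continuousOn
    obtain ⟨s, hs, hzs⟩ := intermediate_value_Ioo' zero_le_one hc hz
    refine ⟨(s, z.fst), ⟨Ioo_subset_Icc_self hs, subset_closure ?_⟩, total_ext rfl hzs⟩
    by_contra hn
    have h := (interp_eq_interp_iff (hτm (zero_lt_one' ℝ)).ne z.fst).2
      ((eq_iff_not_lt_of_le hle z.fst).2 hn)
    linarith [hz.1, hz.2]
  -- By continuity it is enough to treat parameters in the open interval over `ψ < φ`, where the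
  -- inequalities are strict.
  · rw [← closure_Ioo (zero_ne_one' ℝ), ← closure_prod_eq]
    rintro _ ⟨q, hq, rfl⟩
    refine map_mem_closure (f := fun q : ℝ × BaseSpace m =>
      (WithLp.toLp 2 (q.2, interp φ ψ (τ q.1) q.2) : TotalSpace m)) hgc hq ?_
    rintro ⟨σ, x⟩ ⟨hσ, hx⟩
    have hx : 0 < φ x - ψ x := sub_pos.2 hx
    have e1 := interp_sub_interp (φ := φ) (ψ := ψ) (τ 0) (τ σ) x
    have e2 := interp_sub_interp (φ := φ) (ψ := ψ) (τ σ) (τ 1) x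
    have e5 := mul_pos (sub_pos.2 (hτm hσ.1)) hx
    have e6 := mul_pos (sub_pos.2 (hτm hσ.2)) hx
    exact ⟨show interp φ ψ (τ 1) x < interp φ ψ (τ σ) x by linarith,
      show interp φ ψ (τ σ) x < interp φ ψ (τ 0) x by linarith⟩

/-- The region between two interpolations is a strictly convex cap. -/
theorem isStrictlyConvexCap_interp (hφ : ContDiff ℝ 1 φ) (hψ : ContDiff ℝ 1 ψ)
    (hle : ∀ x, ψ x ≤ φ x) (hne : {x | ψ x < φ x}.Nonempty)
    (hbd : Bornology.IsBounded {x | ψ x < φ x}) (hτc : Continuous τ) (hτm : StrictMono τ)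
    (hstr : ∀ s ∈ Icc (0 : ℝ) 1, StrictConvexOn ℝ univ (interp φ ψ (τ s))) :
    IsStrictlyConvexCap
      (closure {z : TotalSpace m |
        interp φ ψ (τ 1) z.fst < z.snd ∧ z.snd < interp φ ψ (τ 0) z.fst})
      (graphPart φ ψ (τ 0)) := by
  have hφc := hφ.continuous
  have hψc := hψ.continuous
  have hgc : Continuous fun q : ℝ × BaseSpace m =>
      (WithLp.toLp 2 (q.2, interp φ ψ (τ q.1) q.2) : TotalSpace m) :=
    (continuous_graphPoint hφc hψc).comp ((hτc.comp continuous_fst).prodMk continuous_snd)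
  have hQ := closure_between_eq hφc hψc hle hbd hτc hτm
  have hω : ∀ s ∈ Ioc (0 : ℝ) 1, levelSet univ (fun s => graphDefining φ ψ (τ s)) s \
      levelSet univ (fun s => graphDefining φ ψ (τ s)) 0 = graphPart φ ψ (τ s) := by
    intro s hs
    rw [levelSet_graphDefining, levelSet_graphDefining]
    ext z
    refine and_congr_right fun hz => ?_
    rw [mem_ofPred_eq] at hz
    rw [mem_ofPred_eq, hz, interp_eq_interp_iff (hτm hs.1).ne', eq_iff_not_lt_of_le hle, not_not]
  have hsub : ∀ s ∈ Icc (0 : ℝ) 1, closure (graphPart φ ψ (τ s)) ⊆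
      closure {z : TotalSpace m |
        interp φ ψ (τ 1) z.fst < z.snd ∧ z.snd < interp φ ψ (τ 0) z.fst} := by
    refine fun s hs => closure_minimal (fun z hz => ?_) isClosed_closure
    rw [hQ]
    exact ⟨(s, z.fst), ⟨hs, subset_closure hz.2⟩, total_ext rfl hz.1.symm⟩
  refine ⟨univ, _, isCapFamily_graphDefining hφ hψ hle hne hbd hτc hτm hstr, ?_, subset_univ _, ?_⟩
  · rw [hQ]
    exact (isCompact_Icc.prod hbd.isCompact_closure).image hgc
  · refine Subset.antisymm (fun z hz => ?_) (union_subset (hsub 0 ⟨le_rfl, zero_le_one⟩)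
      (iUnion₂_subset fun s hs => ?_))
    · rw [hQ] at hz
      obtain ⟨⟨s, x⟩, ⟨hs, hx⟩, rfl⟩ := hz
      rcases hs.1.eq_or_lt with h | h
      · obtain rfl : 0 = s := h
        exact Or.inl (toLp_mem_closure_graphPart hφc hψc _ hx)
      · refine Or.inr (mem_iUnion₂.2 ⟨s, ⟨h, hs.2⟩, ?_⟩)
        rw [hω s ⟨h, hs.2⟩]
        exact toLp_mem_closure_graphPart hφc hψc _ hx
    · rw [hω s hs]
      exact hsub s (Ioc_subset_Icc_self hs)

end Cap

/-! ### Choice of the radius and assembly. -/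

theorem mainTheorem12 (m : ℕ) (φ : BaseSpace m → ℝ)
    (hBCEH : HasBCEH (epi φ)) (hC1 : HasC1Boundary (epi φ))
    (hbdd : BddBelow (range φ)) (hstrict : StrictlyConvexNearInfinity φ) :
    ∃ r₀ : ℝ, 0 < r₀ ∧ ∀ r : ℝ, r₀ ≤ r → ∃ ψ : BaseSpace m → ℝ,
      convexHull ℝ (epi φ ∪ Metric.closedBall (0 : TotalSpace m) r) = epi ψ ∧
      HasBCEH (epi ψ) ∧
      ConvexOn ℝ univ ψ ∧
      ContDiff ℝ 1 ψ ∧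
      (∀ x, ψ x ≤ φ x) ∧
      ψ =ᶠ[cocompact (BaseSpace m)] φ ∧
      (∀ t : ℝ, 0 < t → t < 1 → StrictConvexOn ℝ univ (interp φ ψ t)) ∧
      ∀ t₀ t₁ : ℝ, 0 < t₀ → t₀ < t₁ → t₁ < 1 →
        ∃ ω₀ : Set (TotalSpace m), ω₀ ⊆ graphOf (interp φ ψ t₀) ∧
          IsStrictlyConvexCap
            (closure {z : TotalSpace m |
              interp φ ψ t₁ z.fst < z.snd ∧ z.snd < interp φ ψ t₀ z.fst}) ω₀ := by
  have hφ := convexOn_of_convex_epi hBCEH.convex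
  have hφd := differentiable_of_hasC1Boundary hφ hC1
  obtain ⟨a, b, ha, hb, hgrowth⟩ := exists_linear_growth hBCEH hbdd
  obtain ⟨K, hK, hKs⟩ := hstrict
  obtain ⟨R', hR'⟩ := hK.isBounded.subset_closedBall 0
  set R := max R' 0 + 1 with hR
  have hR0 : 0 ≤ R := by positivity
  have hs : ∀ x, R ≤ ‖x‖ → ∃ U ∈ 𝓝 x, StrictConvexOn ℝ U φ := fun x hx => hKs x fun hxK => by
    have := mem_closedBall_zero_iff.1 (hR' hxK)
    linarith [le_max_left R' 0]
  have hRa : 0 ≤ R / a := by positivity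
  -- Large enough for `b < r` and `R + R / a < r`; the first also makes `ψ` differ from `φ` at `0`.
  refine ⟨b + (R + R / a) + 1, by positivity, fun r hr => ?_⟩
  have hr0 : 0 < r := by linarith
  have hbr : b ≤ r := by linarith
  have hRr : R + R / a < r := by linarith
  obtain ⟨ψ, hψ⟩ := exists_convexHull_eq_epi hBCEH hbdd hr0.le
  have hle := le_of_convexHull_eq_epi hψ
  have hev := eventuallyEq_of_convexHull_eq_epi hBCEH hψ
  have hψd := contDiff_of_convexHull_eq_epi hφd hBCEH.convex hr0 hψ
  have hstr : ∀ t : ℝ, 0 < t → t < 1 → StrictConvexOn ℝ univ (interp φ ψ t) := fun t =>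
    strictConvexOn_interp ha hb hgrowth hbr hR0 hRr hφ hs hψ
  refine ⟨ψ, hψ, hψ ▸ hBCEH.convexHull_union_closedBall epi_nonempty hr0.le,
    convexOn_of_convexHull_eq_epi hψ, hψd, hle, hev, hstr, fun t₀ t₁ h0 h01 h1 => ?_⟩
  have hd : 0 < t₁ - t₀ := sub_pos.2 h01
  -- The affine `τ` carries `[0, 1]` onto `[t₀, t₁]`, inside the open interval where the
  -- interpolations are strictly convex.
  have hcap := isStrictlyConvexCap_interp (τ := fun s => t₀ + s * (t₁ - t₀)) (hφ.contDiff_one hφd)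
    hψd hle ⟨0, ?_⟩ ?_ (by fun_prop) (fun s t hst => by
      have := mul_lt_mul_of_pos_right hst hd
      linarith) (fun s hs => hstr _ (by nlinarith [hs.1]) (by nlinarith [hs.2]))
  · simp only [zero_mul, add_zero, one_mul, add_sub_cancel] at hcap
    exact ⟨_, fun z hz => hz.1, hcap⟩
  -- The base is nonempty, since `ψ 0 ≤ -r < -b ≤ φ 0`.
  · have e1 := le_neg_sqrt_of_convexHull_eq_epi hr0.le hψ (x := 0) (by simpa using hr0.le)
    rw [norm_zero, zero_pow two_ne_zero, sub_zero, Real.sqrt_sq hr0.le] at e1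
    have e2 := hgrowth 0
    rw [norm_zero, mul_zero, zero_sub] at e2
    exact show ψ 0 < φ 0 by linarith
  · obtain ⟨C, hC, hsub⟩ := mem_cocompact.1 hev
    refine hC.isBounded.subset fun x hx => ?_
    by_contra hn
    exact (ne_of_lt hx) (hsub hn)
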